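/- **Setting.** Let $(X,\mathscr B,\nu)$ be a $\sigma$-finite measure space, $\mathscr B_{fin}=\{A\in\mathscr B:\nu(A)<\infty\}$, and let $\mathscr D_{fin}\subset L^2(\nu)$ be the linear span of the indicators $\chi_A$, $A\in\mathscr B_{fin}$ (all spaces are real). Let $S$ be a closed (for instance selfadjoint) linear operator in $L^2(\nu)$ for which $\mathscr D_{fin}$ is a core, and let $k_A=S\chi_A$ and $K(A,B)=\langle k_A,k_B\rangle_{L^2(\nu)}$ for $A,B\in\mathscr B_{fin}$. Let $(W_A)_{A\in\mathscr B_{fin}}$ be a centered real Gaussian process on a probability space $(\Omega,\mathbb P)$ with $\mathbb E(W_AW_B)=K(A,B)$ for all $A,B\in\mathscr B_{fin}$. *Itô integral.* For $\psi=\sum_i\alpha_i\chi_{A_i}\in\mathscr D_{fin}$ put $\int\psi\,dW=\sum_i\alpha_iW_{A_i}$. For a measurable $\varphi:X\to\mathbb R$, the Itô integral $\int\varphi\,dW$ exists in $L^2(\mathbb P)$ if there are $\varphi_n\in\mathscr D_{fin}$ with $\varphi_n\to\varphi$ in $L^2(\nu)$ such that $\int\varphi_n\,dW$ converges in $L^2(\mathbb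 P)$; the limit (which does not depend on the choice of $\varphi_n$) is then $\int\varphi\,dW$. If the Itô integral does not exist, one puts $\mathbb E(|\int\varphi\,dW|^2)=\infty$. *Partitions.* Let $\mathscr A$ range over the countable partitions of $X$ into sets of $\mathscr B_{fin}$; write $\mathscr A\le\mathscr A'$ if $\mathscr A'$ refines $\mathscr A$, and let $\mathscr C_{\mathscr A}$ be the $\sigma$-algebra generated by $\{W_A: A\in\mathscr A\}$. The symbol $\mathbb E(|\int\varphi\,dW|^2\mid\mathscr C_{\mathscr A})\in[0,\infty]$ denotes the second moment of the projection of $\int\varphi\,dW$ to the $\mathscr C_{\mathscr A}$-measurable functions in $L^2(\mathbb P)$, $$\mathbb E\Big(\Big|\int\varphi\,dW\Big|^2\;\Big|\;\mathscr C_{\mathscr A}\Big):=\mathbb E\Big(\Big|\mathbb E\Big(\int\varphi\,dW\;\Big|\;\mathscr C_{\mathscr A}\Big)\Big|^2\Big)$$ if the Itô integral exists, where the inner symbol on the right is the usual conditional expectation, and $\infty$ otherwise. **Corollary 5.2 (Monotonicity).** For every measurable $\varphi:X\to\mathbb R$: 1. if $\mathscr A\le\mathscr A'$, then $\mathbb E(|\int\varphi\,dW|^2\mid\mathscr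 C_{\mathscr A})\le\mathbb E(|\int\varphi\,dW|^2\mid\mathscr C_{\mathscr A'})$; 2. $\sup_{\mathscr A}\mathbb E(|\int\varphi\,dW|^2\mid\mathscr C_{\mathscr A})=\mathbb E(|\int\varphi\,dW|^2)$; 3. this supremum over all partitions is finite if and only if $\varphi\in\mathrm{dom}(S)$ (that is, the class of $\varphi$ is an element of $L^2(\nu)$ lying in $\mathrm{dom}(S)$). -/

import Mathlib

open MeasureTheory ProbabilityTheory
open scoped ENNReal InnerProductSpace

namespace GaussianField

noncomputable section

/-- The family `𝓑_fin` of measurable sets of finite measure. -/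
abbrev Bfin {X : Type*} [MeasurableSpace X] (ν : Measure X) : Type _ :=
  {A : Set X // MeasurableSet A ∧ ν A < ∞}

/-- The indicator function of `A ∈ 𝓑_fin`, as an element of `L²(ν)`. -/
def chi {X : Type*} [MeasurableSpace X] (ν : Measure X) (A : Bfin ν) : Lp ℝ 2 ν :=
  indicatorConstLp 2 A.2.1 A.2.2.ne (1 : ℝ)

/-- `𝓓_fin`: the finite linear combinations of indicators of sets in `𝓑_fin`. -/
def Dfin {X : Type*} [MeasurableSpace X] (ν : Measure X) : Submodule ℝ (Lp ℝ 2 ν) :=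
  Submodule.span ℝ (Set.range (chi ν))

/-- The function `φ` represents an element of the domain of the operator `S` in `L²(ν)`. -/
def InDomain {X : Type*} [MeasurableSpace X] {ν : Measure X}
    (S : Lp ℝ 2 ν →ₗ.[ℝ] Lp ℝ 2 ν) (φ : X → ℝ) : Prop :=
  ∃ f ∈ S.domain, f =ᵐ[ν] φ

/-- A countable partition of `X` into (nonempty) sets from `𝓑_fin`. -/
structure CountablePartition {X : Type*} [MeasurableSpace X] (ν : Measure X) where
  parts : Set (Set X)
  countable : parts.Countable
  isPartition : Setoid.IsPartition parts
  mem_Bfin : ∀ A ∈ parts, MeasurableSet A ∧ ν A < ∞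

/-- `𝒜.RefinedBy 𝒜'` is the ordering `𝒜 ≤ 𝒜'`: the partition `𝒜'` is a refinement of `𝒜`. -/
def CountablePartition.RefinedBy {X : Type*} [MeasurableSpace X] {ν : Measure X}
    (𝒜 𝒜' : CountablePartition ν) : Prop :=
  ∀ A' ∈ 𝒜'.parts, ∃ A ∈ 𝒜.parts, A' ⊆ A

/-- `𝓒_𝒜`: the sigma-algebra generated by the variables `W_A`, `A ∈ 𝒜`. -/
@[reducible] def cylinderAlgebra {X Ω : Type*} [MeasurableSpace X] {ν : Measure X}
    (W : Bfin ν → Ω → ℝ) (𝒜 : CountablePartition ν) : MeasurableSpace Ω :=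
  ⨆ A : {A : Bfin ν // A.1 ∈ 𝒜.parts}, MeasurableSpace.comap (W A.1) inferInstance

/-- The graph of the elementary integral `∑ αᵢ χ_{Aᵢ} ↦ ∑ αᵢ W_{Aᵢ}`, inside `L²(ν) × L²(P)`. -/
def elementaryGraph {X Ω : Type*} [MeasurableSpace X] [MeasurableSpace Ω] {ν : Measure X}
    (P : Measure Ω) (W : Bfin ν → Ω → ℝ) : Submodule ℝ (Lp ℝ 2 ν × Lp ℝ 2 P) :=
  Submodule.span ℝ {p | ∃ A : Bfin ν, p.1 = chi ν A ∧ p.2 =ᵐ[P] W A}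

/-- `F ∈ L²(P)` is an Itô integral of `φ`: there are simple functions `φₙ ∈ 𝓓_fin` such that
`φₙ → φ` in `L²(ν)` and `∫ φₙ dW → F` in `L²(P)`. -/
def IsItoIntegral {X Ω : Type*} [MeasurableSpace X] [MeasurableSpace Ω] {ν : Measure X}
    (P : Measure Ω) (W : Bfin ν → Ω → ℝ) (φ : X → ℝ) (F : Lp ℝ 2 P) : Prop :=
  ∃ f : Lp ℝ 2 ν, f =ᵐ[ν] φ ∧ (f, F) ∈ (elementaryGraph P W).topologicalClosure

/-- The Itô integral `∫ φ dW` exists in `L²(P)`. -/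
def ItoIntegrable {X Ω : Type*} [MeasurableSpace X] [MeasurableSpace Ω] {ν : Measure X}
    (P : Measure Ω) (W : Bfin ν → Ω → ℝ) (φ : X → ℝ) : Prop :=
  ∃ F : Lp ℝ 2 P, IsItoIntegral P W φ F

open Classical in
/-- The Itô integral `∫ φ dW ∈ L²(P)` (with the value `0` where it does not exist). -/
def itoIntegral {X Ω : Type*} [MeasurableSpace X] [MeasurableSpace Ω] {ν : Measure X}
    (P : Measure Ω) (W : Bfin ν → Ω → ℝ) (φ : X → ℝ) : Lp ℝ 2 P :=
  if h : ItoIntegrable P W φ then h.choose else 0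

open Classical in
/-- `𝔼(|∫ φ dW|²) ∈ [0, ∞]`; it is `∞` if the Itô integral does not exist in `L²(P)`. -/
def secondMoment {X Ω : Type*} [MeasurableSpace X] [MeasurableSpace Ω] {ν : Measure X}
    (P : Measure Ω) (W : Bfin ν → Ω → ℝ) (φ : X → ℝ) : ℝ≥0∞ :=
  if ItoIntegrable P W φ then ∫⁻ ω, ‖itoIntegral P W φ ω‖ₑ ^ 2 ∂P else ∞

open Classical in
/-- `𝔼(|∫ φ dW|² ∣ 𝓒_𝒜) ∈ [0, ∞]`: the second moment of the projection `𝔼(∫ φ dW ∣ 𝓒_𝒜)` of the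
Itô integral to the `𝓒_𝒜`-measurable functions in `L²(P)`; it is `∞` if the Itô integral does not
exist in `L²(P)`. -/
def condSecondMoment {X Ω : Type*} [MeasurableSpace X] [MeasurableSpace Ω] {ν : Measure X}
    (P : Measure Ω) (W : Bfin ν → Ω → ℝ) (φ : X → ℝ) (𝒜 : CountablePartition ν) : ℝ≥0∞ :=
  if ItoIntegrable P W φ then
    ∫⁻ ω, ‖(P[itoIntegral P W φ | cylinderAlgebra W 𝒜]) ω‖ₑ ^ 2 ∂P
  else ∞

/-- A Gaussian process has square integrable values, so the generators of `elementaryGraph` exist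
and are determined by the set. -/
theorem exists_toLp {X Ω : Type*} [MeasurableSpace X] [MeasurableSpace Ω] {ν : Measure X}
    {P : Measure Ω} {W : Bfin ν → Ω → ℝ} (hG : IsGaussianProcess W P) (A : Bfin ν) :
    ∃ w : Lp ℝ 2 P, w =ᵐ[P] W A :=
  ⟨MemLp.toLp _ ((hG.hasGaussianLaw_eval A).memLp_two), MemLp.coeFn_toLp _⟩

/-- The Itô integral is well defined. -/
theorem IsItoIntegral.unique {X Ω : Type*} [MeasurableSpace X] [MeasurableSpace Ω] {ν : Measure X}
    {P : Measure Ω} {W : Bfin ν → Ω → ℝ} {S : Lp ℝ 2 ν →ₗ.[ℝ] Lp ℝ 2 ν} (hS : S.IsClosed)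
    {k : Bfin ν → Lp ℝ 2 ν} (hk : ∀ A, (chi ν A, k A) ∈ S.graph)
    (hG : IsGaussianProcess W P)
    (hcov : ∀ A B, ∫ ω, W A ω * W B ω ∂P = ⟪k A, k B⟫_ℝ)
    {φ : X → ℝ} {F F' : Lp ℝ 2 P} (hF : IsItoIntegral P W φ F) (hF' : IsItoIntegral P W φ F') :
    F = F' := by
  choose w hw using exists_toLp hG
  have hww : ∀ A B, ⟪k A, k B⟫_ℝ = ⟪w A, w B⟫_ℝ := by
    intro A B
    rw [← hcov, L2.inner_def]
    apply integral_congr_ae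
    filter_upwards [hw A, hw B] with ω h1 h2
    simp [h1, h2, mul_comm]
  let T : Set (Lp ℝ 2 ν × Lp ℝ 2 ν × Lp ℝ 2 P) := Set.range fun A => (chi ν A, k A, w A)
  have hiso : ∀ q ∈ Submodule.span ℝ T, ∀ q' ∈ Submodule.span ℝ T,
      ⟪q.2.1, q'.2.1⟫_ℝ = ⟪q.2.2, q'.2.2⟫_ℝ := by
    intro q hq q' hq'
    induction hq, hq' using Submodule.span_induction₂ with
    | mem_mem x y hx hy =>
      obtain ⟨A, rfl⟩ := hx
      obtain ⟨B, rfl⟩ := hy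
      exact hww A B
    | zero_left => simp
    | zero_right => simp
    | add_left x y z _ _ _ h1 h2 => simp [inner_add_left, h1, h2]
    | add_right x y z _ _ _ h1 h2 => simp [inner_add_right, h1, h2]
    | smul_left r x y _ _ h => simp [inner_smul_left, h]
    | smul_right r x y _ _ h => simp [inner_smul_right, h]
  have hgr : ∀ q ∈ Submodule.span ℝ T, (q.1, q.2.1) ∈ S.graph := by
    intro q hq
    induction hq using Submodule.span_induction with
    | mem x hx => obtain ⟨A, rfl⟩ := hx; exact hk A
    | zero => exact S.graph.zero_mem
    | add x y _ _ h1 h2 => exact S.graph.add_mem h1 h2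
    | smul r x _ h => exact S.graph.smul_mem r h
  have hlift : ∀ p ∈ elementaryGraph P W, ∃ q ∈ Submodule.span ℝ T, q.1 = p.1 ∧ q.2.2 = p.2 := by
    intro p hp
    induction hp using Submodule.span_induction with
    | mem x hx =>
      obtain ⟨A, h1, h2⟩ := hx
      exact ⟨_, Submodule.subset_span ⟨A, rfl⟩, h1.symm, Lp.ext ((hw A).trans h2.symm)⟩
    | zero => exact ⟨0, Submodule.zero_mem _, rfl, rfl⟩
    | add x y _ _ h1 h2 =>
      obtain ⟨q, hq, a, b⟩ := h1
      obtain ⟨q', hq', a', b'⟩ := h2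
      exact ⟨q + q', Submodule.add_mem _ hq hq', by simp [a, a'], by simp [b, b']⟩
    | smul r x _ h =>
      obtain ⟨q, hq, a, b⟩ := h
      exact ⟨r • q, Submodule.smul_mem _ _ hq, by simp [a], by simp [b]⟩
  obtain ⟨f, hf, hm⟩ := hF
  obtain ⟨f', hf', hm'⟩ := hF'
  have hff : f = f' := Lp.ext (hf.trans hf'.symm)
  subst hff
  have hD : ((0 : Lp ℝ 2 ν), F - F') ∈ (elementaryGraph P W).topologicalClosure := by
    simpa using Submodule.sub_mem _ hm hm'
  rw [← SetLike.mem_coe, Submodule.topologicalClosure_coe, mem_closure_iff_seq_limit] at hD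
  obtain ⟨u, hu, hlim⟩ := hD
  choose q hq hq1 hq2 using fun n => hlift (u n) (hu n)
  have hl1 : Filter.Tendsto (fun n => (q n).1) Filter.atTop (nhds 0) := by
    simp only [hq1]; exact ((continuous_fst.tendsto _).comp hlim)
  have hl2 : Filter.Tendsto (fun n => (q n).2.2) Filter.atTop (nhds (F - F')) := by
    simp only [hq2]; exact ((continuous_snd.tendsto _).comp hlim)
  have hnorm : ∀ q ∈ Submodule.span ℝ T, ‖q.2.1‖ = ‖q.2.2‖ := by
    intro q hq
    rw [norm_eq_sqrt_real_inner, norm_eq_sqrt_real_inner, hiso q hq q hq]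
  have hc : CauchySeq fun n => (q n).2.1 := by
    have := hl2.cauchySeq
    rw [Metric.cauchySeq_iff] at this ⊢
    intro ε hε
    obtain ⟨N, hN⟩ := this ε hε
    refine ⟨N, fun m hm n hn => ?_⟩
    have h1 := hnorm _ (Submodule.sub_mem _ (hq m) (hq n))
    have h2 := hN m hm n hn
    rw [dist_eq_norm] at h2 ⊢
    simpa [h1] using (h1.trans_lt h2)
  obtain ⟨g, hg⟩ := cauchySeq_tendsto_of_complete hc
  have hmem : ((0 : Lp ℝ 2 ν), g) ∈ S.graph :=
    hS.mem_of_tendsto (hl1.prodMk_nhds hg) (Filter.Eventually.of_forall fun n => hgr _ (hq n))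
  have hg0 : g = 0 := S.graph_fst_eq_zero_snd hmem rfl
  subst hg0
  have h3 : Filter.Tendsto (fun n => ‖(q n).2.2‖) Filter.atTop (nhds 0) := by
    have := hg.norm
    simp only [norm_zero] at this
    exact this.congr fun n => hnorm _ (hq n)
  have h4 : ‖F - F'‖ = 0 := tendsto_nhds_unique hl2.norm h3
  exact sub_eq_zero.mp (norm_eq_zero.mp h4)

end

end GaussianField

/-!
Sending `k_A = S χ_A` to `W_A` preserves inner products, so the Itô integral is `S` followed by a
partial isometry, and it exists exactly on `dom S`. The quantities conditioned on a partition are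
the squared norms of the projections of `∫ φ dW` onto the closed subspaces `L²(𝓒_𝒜)`. These
subspaces increase with `𝒜`, and the closure of their union contains the closed span of the process,
once one knows that `W_A` is almost surely `𝓒_𝒜`-measurable whenever `A` is a union of parts of `𝒜`.

That is the delicate point: `χ_A` is the sum in `L²(ν)` of the indicators of the parts, but `S` is
unbounded, so that `S χ_A` need not be the sum of their images. Each subsum is again an indicator,
hence lies in `dom S`, and by Baire's theorem on `2^ι` the operator `S` is bounded on the subsums
that avoid some finite set of indices. The images of the finite subsums then accumulate weakly, and
as the graph of `S` and closed subspaces are weakly closed, `S χ_A` lies in the closed span of the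
images of the parts.
-/

namespace GaussianField

open Filter Topology Bornology Function

theorem continuous_tsum_indicator {ι E : Type*} [NormedAddCommGroup E] [CompleteSpace E]
    {x : ι → E} (hx : Summable x) :
    Continuous fun c : ι → Bool => ∑' i, {i | c i}.indicator x i := by
  refine TendstoUniformly.continuous (p := atTop)
    (F := fun (J : Finset ι) c => ∑ i ∈ J, {i | c i}.indicator x i) ?_ (.of_forall fun J => ?_)
  · rw [Metric.tendstoUniformly_iff]
    intro ε hε
    obtain ⟨I, hI⟩ := hx.tsum_vanishing (Metric.ball_mem_nhds 0 hε)
    filter_upwards [eventually_ge_atTop I] with J hJ c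
    have htail : ∑' i : ((J : Set ι)ᶜ : Set ι), {i | c i}.indicator x i =
        ∑' i : ({i | c i} \ J : Set ι), x i := by
      rw [tsum_subtype, tsum_subtype, Set.indicator_indicator, Set.inter_comm, Set.sdiff_eq]
    rw [dist_eq_norm, ← (hx.indicator {i | c i}).sum_add_tsum_compl (s := J),
      add_sub_cancel_left, htail, ← mem_ball_zero_iff]
    exact hI _ (Set.disjoint_sdiff_left.mono_right (by exact_mod_cast hJ))
  · refine continuous_finsetSum _ fun i _ => ?_
    exact (continuous_of_discreteTopology (f := {b : Bool | b}.indicator fun _ => x i)).comp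
      (continuous_apply (A := fun _ => Bool) i)

section ClosedOperator

variable {E F : Type*} [NormedAddCommGroup E] [NormedSpace ℝ E]
  [NormedAddCommGroup F] [InnerProductSpace ℝ F] [CompleteSpace F]

theorem exists_tendsto_dual_of_norm_le {α : Type*} (u : Ultrafilter α) {y : α → F} {N : ℝ}
    (hy : ∀ᶠ a in u, ‖y a‖ ≤ N) :
    ∃ y₀, ∀ f : StrongDual ℝ F, Tendsto (fun a => f (y a)) u (𝓝 (f y₀)) := by
  let D := InnerProductSpace.toDual ℝ F
  let T : α → WeakDual ℝ F := fun a => StrongDual.toWeakDual (D (y a))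
  have hT : ∀ᶠ a in u, T a ∈ WeakDual.toStrongDual ⁻¹' Metric.closedBall 0 N := by
    filter_upwards [hy] with a ha
    simpa [T] using ha
  obtain ⟨z, -, hz⟩ := (WeakDual.isCompact_closedBall (𝕜 := ℝ) (E := F) 0 N).ultrafilter_le_nhds
    (u.map T) (le_principal_iff.2 hT)
  refine ⟨D.symm (WeakDual.toStrongDual z), fun f => ?_⟩
  have hf : ∀ v, f v = ⟪v, D.symm f⟫_ℝ := fun v => by
    rw [real_inner_comm, InnerProductSpace.toDual_symm_apply]
  simp only [hf, D, InnerProductSpace.toDual_symm_apply]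
  exact ((WeakDual.eval_continuous _).tendsto z).comp hz

theorem isClosed_image_fst_inter_preimage_snd {C : Set (E × F)} (hC : Convex ℝ C)
    (hC' : IsClosed C) {B : Set F} (hB : Convex ℝ B) (hB' : IsClosed B) (hbdd : IsBounded B) :
    IsClosed (Prod.fst '' (C ∩ Prod.snd ⁻¹' B)) := by
  have hconv := hC.inter (hB.linear_preimage (LinearMap.snd ℝ E F))
  have hclosed := hC'.inter (hB'.preimage continuous_snd)
  refine isClosed_of_closure_subset fun x₀ hx₀ => ?_
  obtain ⟨x, hxC, hx⟩ := mem_closure_iff_seq_limit.1 hx₀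
  choose p hp hpx using hxC
  obtain ⟨N, hN⟩ := hbdd.exists_norm_le
  obtain ⟨y₀, hy₀⟩ := exists_tendsto_dual_of_norm_le (.of atTop) (y := fun n => (p n).2)
    (.of_forall fun n => hN _ (hp n).2)
  suffices (x₀, y₀) ∈ C ∩ Prod.snd ⁻¹' B from ⟨_, this, rfl⟩
  by_contra hmem
  obtain ⟨f, r, hf, hr⟩ := geometric_hahn_banach_closed_point hconv hclosed hmem
  have hsplit : ∀ q : E × F, f q = f.comp (.inl ℝ E F) q.1 + f.comp (.inr ℝ E F) q.2 := fun q => by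
    simp [← map_add]
  have hlim : Tendsto (fun n => f (p n)) (Ultrafilter.of (atTop : Filter ℕ)) (𝓝 (f (x₀, y₀))) := by
    simp only [hsplit, hpx]
    exact ((ContinuousLinearMap.continuous _).tendsto x₀ |>.comp
      (hx.mono_left (Ultrafilter.of_le _))).add (hy₀ _)
  exact hr.not_ge (le_of_tendsto' hlim fun n => (hf _ (hp n)).le)

variable [CompleteSpace E] {T : E →ₗ.[ℝ] F} {ι : Type*} {x : ι → E}

theorem exists_finset_forall_disjoint_norm_le (hT : T.IsClosed) (hx : Summable x)
    (hdom : ∀ s : Set ι, ∑' i, s.indicator x i ∈ T.domain) :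
    ∃ (I : Finset ι) (N : ℝ), ∀ s : Set ι, Disjoint s I →
      ∃ y, (∑' i, s.indicator x i, y) ∈ T.graph ∧ ‖y‖ ≤ N := by
  classical
  choose y hy using fun s => LinearPMap.mem_domain_iff.1 (hdom s)
  let D (n : ℕ) : Set E :=
    Prod.fst '' ((T.graph : Set (E × F)) ∩ Prod.snd ⁻¹' Metric.closedBall 0 n)
  have hD (n : ℕ) : IsClosed (D n) := isClosed_image_fst_inter_preimage_snd T.graph.convex hT
    (convex_closedBall 0 _) Metric.isClosed_closedBall Metric.isBounded_closedBall
  have hcover (c : ι → Bool) : ∃ n, ∑' i, {i | c i}.indicator x i ∈ D n :=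
    (exists_nat_ge ‖y {i | c i}‖).imp fun n hn => ⟨_, ⟨hy _, mem_closedBall_zero_iff.2 hn⟩, rfl⟩
  -- By Baire some `D n` contains the subsums of all subsets of `ι` that agree with a fixed one on a
  -- finite set `I`.
  obtain ⟨n, c₀, hc₀⟩ := nonempty_interior_of_iUnion_of_closed
    (fun n => (hD n).preimage (continuous_tsum_indicator hx))
    (Set.eq_univ_of_forall fun c => Set.mem_iUnion.2 (hcover c))
  rw [mem_interior_iff_mem_nhds, nhds_pi, Filter.mem_pi] at hc₀
  obtain ⟨I, hI, t, ht, hsub⟩ := hc₀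
  let r : Set ι := {i | i ∈ I ∧ c₀ i}
  refine ⟨hI.toFinset, n + ‖y r‖, fun s hs => ?_⟩
  rw [hI.coe_toFinset] at hs
  have hsr : ∑' i, (s ∪ r).indicator x i ∈ D n := by
    have hpi : (fun i => decide (i ∈ s ∪ r)) ∈ I.pi t := fun i hi => by
      have := hs.notMem_of_mem_right hi
      simpa [r, hi, this] using mem_of_mem_nhds (ht i)
    simpa only [Set.mem_preimage, decide_eq_true_eq, Set.ofPred_mem_eq] using hsub hpi
  have hsum : ∑' i, s.indicator x i = ∑' i, (s ∪ r).indicator x i - ∑' i, r.indicator x i := by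
    rw [eq_sub_iff_add_eq, ← (hx.indicator s).tsum_add (hx.indicator r),
      Set.indicator_union_of_disjoint (hs.mono_right fun i hi => hi.1)]
  obtain ⟨⟨_, z⟩, ⟨hz, hzn⟩, rfl : _ = _⟩ := hsr
  refine ⟨z - y r, hsum ▸ T.graph.sub_mem hz (hy r), (norm_sub_le _ _).trans ?_⟩
  exact add_le_add_left (mem_closedBall_zero_iff.1 hzn) _

theorem mem_of_tsum_mem_graph (hT : T.IsClosed) (hx : Summable x)
    (hdom : ∀ s : Set ι, ∑' i, s.indicator x i ∈ T.domain)
    {M : Submodule ℝ F} (hM : IsClosed (M : Set F)) {y : ι → F}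
    (hxy : ∀ i, (x i, y i) ∈ T.graph) (hyM : ∀ i, y i ∈ M) {z : F}
    (hz : (∑' i, x i, z) ∈ T.graph) : z ∈ M := by
  classical
  obtain ⟨I, N, hN⟩ := exists_finset_forall_disjoint_norm_le hT hx hdom
  have hsum (J : Finset ι) : (∑ i ∈ J, x i, ∑ i ∈ J, y i) ∈ T.graph := by
    rw [prod_mk_sum]
    exact T.graph.sum_mem fun i _ => hxy i
  have htail : ∑' i, x i - ∑ i ∈ I, x i ∈
      Prod.fst '' ((T.graph : Set (E × F)) ∩ Prod.snd ⁻¹' (M ∩ Metric.closedBall 0 N)) := by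
    refine (isClosed_image_fst_inter_preimage_snd T.graph.convex hT
      (M.convex.inter (convex_closedBall 0 N)) (hM.inter Metric.isClosed_closedBall)
      (Metric.isBounded_closedBall.subset Set.inter_subset_right)).mem_of_tendsto
      (hx.hasSum.sub_const _) ?_
    filter_upwards [eventually_ge_atTop I] with J hJ
    obtain ⟨b, hb, hbN⟩ := hN ↑(J \ I) (by exact_mod_cast Finset.sdiff_disjoint)
    rw [← tsum_subtype, Finset.tsum_subtype'] at hb
    have hby : b = ∑ i ∈ J \ I, y i := T.mem_graph_snd_inj hb (hsum _) rfl
    rw [← Finset.sum_sdiff hJ, add_sub_cancel_right]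
    exact ⟨_, ⟨hb, hby ▸ M.sum_mem fun i _ => hyM i, mem_closedBall_zero_iff.2 hbN⟩, rfl⟩
  obtain ⟨⟨_, b⟩, ⟨hb, hbM, -⟩, rfl : _ = _⟩ := htail
  have hzb : z = ∑ i ∈ I, y i + b :=
    T.mem_graph_snd_inj hz (T.graph.add_mem (hsum I) hb) (by simp)
  exact hzb ▸ M.add_mem (M.sum_mem fun i _ => hyM i) hbM

end ClosedOperator

section Sum

variable {α E ι : Type*} {m : MeasurableSpace α} {μ : Measure α} {p : ℝ≥0∞} {t : ι → Set α}
  [NormedAddCommGroup E]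

theorem sum_indicatorConstLp (ht : ∀ i, MeasurableSet (t i)) (hμ : ∀ i, μ (t i) ≠ ∞)
    (hd : Pairwise (Disjoint on t)) (c : E) (J : Finset ι) :
    ∑ i ∈ J, indicatorConstLp p (ht i) (hμ i) c = indicatorConstLp p
      (J.measurableSet_biUnion fun i _ => ht i)
      (measure_biUnion_ne_top J.finite_toSet fun i _ => hμ i) c := by
  classical
  induction J using Finset.induction_on with
  | empty => simp
  | insert j J hj ih =>
    have hjJ : Disjoint (t j) (⋃ i ∈ J, t i) :=
      Set.disjoint_iUnion₂_right.2 fun i hi => hd (ne_of_mem_of_not_mem hi hj).symm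
    simp only [Finset.sum_insert hj, ih, Finset.set_biUnion_insert]
    exact (indicatorConstLp_disjoint_union _ _ _ _ hjJ c).symm

theorem hasSum_indicatorConstLp_iUnion [Countable ι] [Fact (1 ≤ p)] (hp : p ≠ ∞)
    (ht : ∀ i, MeasurableSet (t i)) (hd : Pairwise (Disjoint on t)) (hμ : μ (⋃ i, t i) ≠ ∞)
    (c : E) :
    HasSum (fun i => indicatorConstLp p (ht i)
        (measure_ne_top_of_subset (Set.subset_iUnion t i) hμ) c)
      (indicatorConstLp p (.iUnion ht) hμ c) := by
  simp only [HasSum, SummationFilter.unconditional_filter, sum_indicatorConstLp ht _ hd]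
  refine tendsto_indicatorConstLp_set hp (tendsto_of_tendsto_of_tendsto_of_le_of_le
    tendsto_const_nhds (ENNReal.tendsto_tsum_compl_atTop_zero (f := fun i => μ (t i)) ?_)
    (fun J => zero_le) fun J => ?_)
  · rwa [← measure_iUnion hd ht]
  · refine (measure_mono fun x => ?_).trans (measure_iUnion_le fun i : {i // i ∉ J} => t i)
    simp only [Set.mem_symmDiff, Set.mem_iUnion, exists_prop, Subtype.exists]
    grind
end Sum

section Gram

variable {E F ι : Type*} [NormedAddCommGroup E] [InnerProductSpace ℝ E] [NormedAddCommGroup F]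

theorem exists_clm_apply_eq_of_norm_le {V : Type*} [AddCommGroup V] [Module ℝ V] [CompleteSpace E]
    [NormedSpace ℝ F] [CompleteSpace F] {e : V →ₗ[ℝ] E} {f : V →ₗ[ℝ] F}
    (h : ∀ v, ‖f v‖ ≤ ‖e v‖) : ∃ U : E →L[ℝ] F, ∀ v, U (e v) = f v := by
  let M := e.range.topologicalClosure
  let e' : V →ₗ[ℝ] M := e.codRestrict M fun v => e.range.le_topologicalClosure ⟨v, rfl⟩
  have he' : DenseRange e' :=
    ((denseRange_inclusion_iff e.range.le_topologicalClosure).2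
      e.range.topologicalClosure_coe.le).comp e.surjective_rangeRestrict.denseRange
      (continuous_inclusion _)
  refine ⟨(f.extendOfNorm e').comp M.orthogonalProjectionOnto, fun v => ?_⟩
  rw [ContinuousLinearMap.comp_apply, ← LinearMap.codRestrict_apply M (f := e) v,
    Submodule.orthogonalProjectionOnto_mem_subspace_eq_self]
  exact f.extendOfNorm_eq he' ⟨1, by simpa [e'] using h⟩ v

variable [InnerProductSpace ℝ F] {x : ι → E} {y : ι → F}

theorem norm_linearCombination_eq_of_inner_eq (h : ∀ i j, ⟪x i, x j⟫_ℝ = ⟪y i, y j⟫_ℝ)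
    (c : ι →₀ ℝ) :
    ‖Finsupp.linearCombination ℝ x c‖ = ‖Finsupp.linearCombination ℝ y c‖ := by
  simp only [norm_eq_sqrt_real_inner, Finsupp.linearCombination_apply, Finsupp.sum_inner,
    Finsupp.inner_sum, inner_smul_left, inner_smul_right, h]

theorem exists_clm_apply_eq_of_inner_eq [CompleteSpace E] [CompleteSpace F]
    (h : ∀ i j, ⟪x i, x j⟫_ℝ = ⟪y i, y j⟫_ℝ) : ∃ U : E →L[ℝ] F, ∀ i, U (x i) = y i := by
  obtain ⟨U, hU⟩ := exists_clm_apply_eq_of_norm_le fun c =>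
    (norm_linearCombination_eq_of_inner_eq h c).ge
  exact ⟨U, fun i => by simpa using hU (Finsupp.single i 1)⟩

end Gram

section Graph

variable {R E F : Type*} [CommRing R]
  [AddCommGroup E] [Module R E] [AddCommGroup F] [Module R F]

theorem domRestrict_map_fst_graph {T : E →ₗ.[R] F} {g : Submodule R (E × F)} (hg : g ≤ T.graph) :
    (T.domRestrict (g.map (.fst R E F))).graph = g := by
  have hle : (T.domRestrict (g.map (.fst R E F))).graph ≤ T.graph :=
    LinearPMap.le_graph_of_le LinearPMap.domRestrict_le
  apply le_antisymm
  · intro p hp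
    obtain ⟨q, hq, hqp : q.1 = p.1⟩ := (LinearPMap.mem_domain_of_mem_graph hp).1
    rwa [← Prod.ext hqp (T.mem_graph_snd_inj' (hg hq) (hle hp) hqp)]
  · rintro ⟨a, b⟩ hab
    have hdom : a ∈ (T.domRestrict (g.map (.fst R E F))).domain :=
      ⟨⟨_, hab, rfl⟩, LinearPMap.mem_domain_of_mem_graph (hg hab)⟩
    obtain ⟨b', hb'⟩ := LinearPMap.mem_domain_iff.1 hdom
    rwa [T.mem_graph_snd_inj (hg hab) (hle hb') rfl]

variable [TopologicalSpace R] [TopologicalSpace E] [TopologicalSpace F]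
  [ContinuousAdd E] [ContinuousAdd F] [ContinuousSMul R E] [ContinuousSMul R F]

theorem graph_eq_topologicalClosure_of_hasCore {T : E →ₗ.[R] F} (hT : T.IsClosed)
    {g : Submodule R (E × F)} (hg : g ≤ T.graph) (hcore : T.HasCore (g.map (.fst R E F))) :
    T.graph = g.topologicalClosure := by
  have hres : (T.domRestrict (g.map (.fst R E F))).IsClosable :=
    hT.isClosable.leIsClosable LinearPMap.domRestrict_le
  rw [← domRestrict_map_fst_graph hg, hres.graph_closure_eq_closure_graph, hcore.closure_eq]

end Graph

theorem map_mem_topologicalClosure_span_range {R E F ι : Type*} [Ring R]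
    [TopologicalSpace E] [AddCommGroup E] [Module R E] [ContinuousAdd E] [ContinuousConstSMul R E]
    [TopologicalSpace F] [AddCommGroup F] [Module R F] [ContinuousAdd F] [ContinuousConstSMul R F]
    {U : E →L[R] F} {x : ι → E} {y : ι → F} (hU : ∀ i, U (x i) = y i) {v : E}
    (hv : v ∈ (Submodule.span R (Set.range x)).topologicalClosure) :
    U v ∈ (Submodule.span R (Set.range y)).topologicalClosure := by
  refine map_mem_closure U.continuous hv fun z hz => ?_
  obtain rfl : (U ∘ x) = y := funext hU
  rw [Set.range_comp]
  exact Submodule.image_span_subset_span U.toLinearMap _ ⟨z, hz, rfl⟩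

theorem prodMk_map_mem_topologicalClosure_span_range {R E F G ι : Type*} [Ring R]
    [TopologicalSpace E] [AddCommGroup E] [Module R E] [ContinuousAdd E] [ContinuousConstSMul R E]
    [TopologicalSpace F] [AddCommGroup F] [Module R F] [ContinuousAdd F] [ContinuousConstSMul R F]
    [TopologicalSpace G] [AddCommGroup G] [Module R G] [ContinuousAdd G] [ContinuousConstSMul R G]
    {U : F →L[R] G} {x : ι → E} {y : ι → F} {z : ι → G} (hU : ∀ i, U (y i) = z i) {a : E} {b : F}
    (h : (a, b) ∈ (Submodule.span R (Set.range fun i => (x i, y i))).topologicalClosure) :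
    (a, U b) ∈ (Submodule.span R (Set.range fun i => (x i, z i))).topologicalClosure :=
  map_mem_topologicalClosure_span_range (U := (ContinuousLinearMap.id R E).prodMap U)
    (x := fun i => (x i, y i)) (y := fun i => (x i, z i)) (fun i => Prod.ext rfl (hU i)) h

section Chi

variable {X H : Type*} [MeasurableSpace X] {ν : Measure X} [NormedAddCommGroup H]
  [InnerProductSpace ℝ H]

theorem hasSum_chi {ι : Type*} [Countable ι] {t : ι → Bfin ν}
    (hd : Pairwise (Disjoint on fun i => (t i).1)) {A : Bfin ν} (hA : A.1 = ⋃ i, (t i).1) :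
    HasSum (fun i => chi ν (t i)) (chi ν A) := by
  obtain ⟨_, hAm, hAν⟩ := A
  subst hA
  exact hasSum_indicatorConstLp_iUnion ENNReal.ofNat_ne_top (fun i => (t i).2.1) hd hAν.ne 1

theorem mem_topologicalClosure_span_of_eq_iUnion [CompleteSpace H] {S : Lp ℝ 2 ν →ₗ.[ℝ] H}
    (hS : S.IsClosed) {k : Bfin ν → H} (hk : ∀ A, (chi ν A, k A) ∈ S.graph)
    {ι : Type*} [Countable ι] {t : ι → Bfin ν} (hd : Pairwise (Disjoint on fun i => (t i).1))
    {A : Bfin ν} (hA : A.1 = ⋃ i, (t i).1) :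
    k A ∈ (Submodule.span ℝ (Set.range (k ∘ t))).topologicalClosure := by
  have hsum := hasSum_chi hd hA
  refine mem_of_tsum_mem_graph hS hsum.summable (fun s => ?_)
    (Submodule.isClosed_topologicalClosure _) (y := k ∘ t) (fun i => hk (t i))
    (fun i => Submodule.le_topologicalClosure _ (Submodule.subset_span (Set.mem_range_self i)))
    (hsum.tsum_eq ▸ hk A)
  have hsA : ⋃ i : s, (t i).1 ⊆ A.1 :=
    hA ▸ Set.iUnion_subset fun i => Set.subset_iUnion (fun i => (t i).1) i
  have hB := hasSum_chi (t := fun i : s => t i) (fun i j hij => hd (Subtype.coe_ne_coe.2 hij))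
    (A := ⟨⋃ i : s, (t i).1, .iUnion fun i => (t i).2.1, (measure_mono hsA).trans_lt A.2.2⟩) rfl
  rw [← tsum_subtype, hB.tsum_eq]
  exact LinearPMap.mem_domain_of_mem_graph (hk _)

end Chi

section Domain

variable {X Ω H : Type*} [MeasurableSpace X] [MeasurableSpace Ω] {ν : Measure X} {P : Measure Ω}
  [NormedAddCommGroup H] [InnerProductSpace ℝ H]
  {S : Lp ℝ 2 ν →ₗ.[ℝ] H} {k : Bfin ν → H} {W : Bfin ν → Ω → ℝ}

theorem inner_toLp_toLp {f g : Ω → ℝ} (hf : MemLp f 2 P) (hg : MemLp g 2 P) :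
    ⟪hf.toLp, hg.toLp⟫_ℝ = ∫ ω, f ω * g ω ∂P := by
  rw [L2.inner_def]
  refine integral_congr_ae ?_
  filter_upwards [hf.coeFn_toLp, hg.coeFn_toLp] with ω hfω hgω
  rw [hfω, hgω, Real.inner_apply, mul_comm]

theorem elementaryGraph_eq_span (hL2 : ∀ A, MemLp (W A) 2 P) :
    elementaryGraph P W = Submodule.span ℝ (Set.range fun A => (chi ν A, (hL2 A).toLp)) := by
  rw [elementaryGraph]
  congr 1
  ext ⟨f, F⟩
  refine exists_congr fun A => ?_
  rw [Prod.mk.injEq, eq_comm, eq_comm (b := F)]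
  refine and_congr_right fun _ => ⟨fun h => Lp.ext (h.trans (hL2 A).coeFn_toLp.symm), ?_⟩
  rintro rfl
  exact (hL2 A).coeFn_toLp

theorem graph_eq_topologicalClosure_span (hS : S.IsClosed) (hcore : S.HasCore (Dfin ν))
    (hk : ∀ A, (chi ν A, k A) ∈ S.graph) :
    S.graph = (Submodule.span ℝ (Set.range fun A => (chi ν A, k A))).topologicalClosure := by
  refine graph_eq_topologicalClosure_of_hasCore hS
    (Submodule.span_le.2 (Set.range_subset_iff.2 hk)) ?_
  rwa [Submodule.map_span, ← Set.range_comp]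

theorem itoIntegrable_iff [CompleteSpace H] (hS : S.IsClosed) (hcore : S.HasCore (Dfin ν))
    (hk : ∀ A, (chi ν A, k A) ∈ S.graph) (hL2 : ∀ A, MemLp (W A) 2 P)
    (hcov : ∀ A B, ∫ ω, W A ω * W B ω ∂P = ⟪k A, k B⟫_ℝ) {φ : X → ℝ} :
    ItoIntegrable P W φ ↔ ∃ f ∈ S.domain, f =ᵐ[ν] φ := by
  have hinner (A B) : ⟪k A, k B⟫_ℝ = ⟪(hL2 A).toLp, (hL2 B).toLp⟫_ℝ := by
    rw [inner_toLp_toLp, hcov]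
  obtain ⟨U, hU⟩ := exists_clm_apply_eq_of_inner_eq hinner
  obtain ⟨V, hV⟩ := exists_clm_apply_eq_of_inner_eq fun A B => (hinner A B).symm
  simp only [ItoIntegrable, IsItoIntegral, elementaryGraph_eq_span hL2, LinearPMap.mem_domain_iff,
    graph_eq_topologicalClosure_span hS hcore hk]
  constructor
  · rintro ⟨F, f, hf, hF⟩
    exact ⟨f, ⟨V F, prodMk_map_mem_topologicalClosure_span_range hV hF⟩, hf⟩
  · rintro ⟨f, ⟨z, hz⟩, hf⟩
    exact ⟨U z, f, hf, prodMk_map_mem_topologicalClosure_span_range hU hz⟩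

end Domain

section Partition

variable {X : Type*} [MeasurableSpace X] {ν : Measure X}

namespace CountablePartition

instance (𝒜 : CountablePartition ν) : Countable {A : Bfin ν // A.1 ∈ 𝒜.parts} :=
  (𝒜.countable.preimage Subtype.val_injective).to_subtype

/-- The partition into the nonempty fibres of a measurable map with countably many values, all of
whose fibres have finite measure. -/
def fibers {κ : Type*} [MeasurableSpace κ] [MeasurableSingletonClass κ] [Countable κ] (h : X → κ)
    (hh : Measurable h) (hν : ∀ c, ν (h ⁻¹' {c}) < ∞) : CountablePartition ν where
  parts := (Setoid.ker h).classes
  countable := (Set.countable_range fun c => h ⁻¹' {c}).mono (Setoid.classes_ker_subset_fiber_set h)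
  isPartition := Setoid.isPartition_classes _
  mem_Bfin := by
    rintro _ ⟨x, rfl⟩
    exact ⟨hh (measurableSet_singleton (h x)), hν (h x)⟩

/-- `𝒜.Saturates A`: the set `A` is a union of parts of `𝒜`. It is encoded as the absence of parts
meeting both `A` and its complement. -/
def Saturates (𝒜 : CountablePartition ν) (A : Set X) : Prop :=
  ∀ B ∈ 𝒜.parts, B ⊆ A ∨ Disjoint B A

theorem exists_forall_saturates [SigmaFinite ν] {ι : Type*} [Finite ι] {A : ι → Set X}
    (hA : ∀ i, MeasurableSet (A i)) : ∃ 𝒜 : CountablePartition ν, ∀ i, 𝒜.Saturates (A i) := by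
  let h (x : X) : (ι → Prop) × ℕ := (fun i => x ∈ A i, spanningSetsIndex ν x)
  have hh : Measurable h := (measurable_pi_lambda _ fun i =>
    measurable_mem.2 (hA i)).prodMk (measurableSet_spanningSetsIndex ν)
  refine ⟨fibers h hh fun c => (measure_mono ?_).trans_lt (measure_spanningSets_lt_top ν c.2), ?_⟩
  · rintro x rfl
    exact mem_spanningSetsIndex ν x
  · rintro i _ ⟨x, rfl⟩
    have hmem {y} (hy : y ∈ {y | Setoid.ker h y x}) : y ∈ A i ↔ x ∈ A i :=
      iff_of_eq (congrFun (congrArg Prod.fst hy) i)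
    by_cases hx : x ∈ A i
    · exact .inl fun y hy => (hmem hy).2 hx
    · exact .inr (Set.disjoint_left.2 fun y hy => mt (hmem hy).1 hx)

instance [SigmaFinite ν] : Nonempty (CountablePartition ν) :=
  (exists_forall_saturates (A := Empty.elim) nofun).nonempty

theorem RefinedBy.saturates {𝒜 𝒜' : CountablePartition ν} (h : 𝒜.RefinedBy 𝒜') {A : Set X}
    (hA : A ∈ 𝒜.parts) : 𝒜'.Saturates A := by
  intro B hB
  obtain ⟨A', hA', hBA'⟩ := h B hB
  obtain rfl | hne := eq_or_ne A' A
  · exact .inl hBA'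
  · exact .inr ((𝒜.isPartition.pairwiseDisjoint hA' hA hne).mono_left hBA')

theorem Saturates.eq_iUnion {𝒜 : CountablePartition ν} {A : Set X} (hA : 𝒜.Saturates A) :
    A = ⋃ B : {B : Bfin ν // B.1 ∈ 𝒜.parts ∧ B.1 ⊆ A}, B.1.1 := by
  refine Set.Subset.antisymm (fun x hx => ?_) (Set.iUnion_subset fun B => B.2.2)
  obtain ⟨B, ⟨hB, hxB⟩, -⟩ := 𝒜.isPartition.2 x
  have hBA : B ⊆ A := (hA B hB).resolve_right fun hd => Set.disjoint_left.1 hd hxB hx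
  exact Set.mem_iUnion.2 ⟨⟨⟨B, 𝒜.mem_Bfin B hB⟩, hB, hBA⟩, hxB⟩

end CountablePartition

end Partition

section Projection

variable {𝕜 E : Type*} [RCLike 𝕜] [NormedAddCommGroup E] [InnerProductSpace 𝕜 E]

theorem norm_starProjection_le_of_le {K L : Submodule 𝕜 E} [K.HasOrthogonalProjection]
    [L.HasOrthogonalProjection] (h : K ≤ L) (x : E) :
    ‖K.starProjection x‖ ≤ ‖L.starProjection x‖ := by
  rw [← Submodule.starProjection_comp_starProjection_of_le h]
  exact K.norm_starProjection_apply_le _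

theorem iSup_enorm_starProjection {ι : Type*} (K : ι → Submodule 𝕜 E)
    [∀ i, (K i).HasOrthogonalProjection] {x : E} (hx : x ∈ closure (⋃ i, (K i : Set E))) :
    ⨆ i, ‖(K i).starProjection x‖ₑ = ‖x‖ₑ := by
  refine le_antisymm
    (iSup_le fun i => enorm_le_iff_norm_le.2 ((K i).norm_starProjection_apply_le x))
    (ENNReal.le_of_forall_pos_le_add fun ε hε _ => ?_)
  obtain ⟨y, hy, hxy⟩ := EMetric.mem_closure_iff.1 hx ε (ENNReal.coe_pos.2 hε)
  obtain ⟨i, hyi⟩ := Set.mem_iUnion.1 hy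
  have hdist : ‖x - (K i).starProjection x‖ ≤ ‖x - y‖ := by
    rw [Submodule.starProjection_minimal]
    exact ciInf_le ⟨0, Set.forall_mem_range.2 fun _ => norm_nonneg _⟩ (⟨y, hyi⟩ : K i)
  calc
    ‖x‖ₑ = ‖(K i).starProjection x + (x - (K i).starProjection x)‖ₑ := by rw [add_sub_cancel]
    _ ≤ ‖(K i).starProjection x‖ₑ + ‖x - (K i).starProjection x‖ₑ := enorm_add_le _ _
    _ ≤ (⨆ i, ‖(K i).starProjection x‖ₑ) + ε := by
      gcongr
      · exact le_iSup (fun i => ‖(K i).starProjection x‖ₑ) i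
      · exact (enorm_le_iff_norm_le.2 hdist).trans (edist_eq_enorm_sub x y ▸ hxy.le)

end Projection

section ConditionalExpectation

variable {Ω : Type*} {m mΩ : MeasurableSpace Ω} {P : Measure Ω}

theorem aestronglyMeasurable_of_iSup_comap {ι E : Type*} [Countable ι] [TopologicalSpace E]
    [TopologicalSpace.IsCompletelyMetrizableSpace E] [Nonempty E] {β : ι → Type*}
    [∀ i, TopologicalSpace (β i)] [∀ i, TopologicalSpace.PseudoMetrizableSpace (β i)]
    [∀ i, MeasurableSpace (β i)] [∀ i, BorelSpace (β i)] {W : ∀ i, Ω → β i}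
    (hW : ∀ i, AEStronglyMeasurable[m] (W i) P) {f : Ω → E}
    (hf : AEStronglyMeasurable[⨆ i, MeasurableSpace.comap (W i) inferInstance] f P) :
    AEStronglyMeasurable[m] f P := by
  obtain ⟨g, hg, hfg⟩ := hf
  have hcomap : (⨆ i, MeasurableSpace.comap (W i) inferInstance : MeasurableSpace Ω) =
      MeasurableSpace.comap (fun ω i => W i ω) MeasurableSpace.pi := by
    simp only [MeasurableSpace.pi, MeasurableSpace.comap_iSup, MeasurableSpace.comap_comp, comp_def]
  rw [hcomap] at hg
  obtain ⟨h, hh, rfl⟩ := hg.exists_eq_measurable_comp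
  refine ⟨fun ω => h fun i => (hW i).mk (W i) ω, hh.comp_measurable ?_, ?_⟩
  · exact @measurable_pi_lambda _ _ _ m _ _ fun i => (hW i).stronglyMeasurable_mk.measurable
  · filter_upwards [hfg, ae_all_iff.2 fun i => (hW i).ae_eq_mk] with ω hfω hWω
    simp only [hfω, comp_apply, hWω]

theorem toLp_mem_lpMeas_iff {𝕜 F : Type*} [RCLike 𝕜] [NormedAddCommGroup F] [NormedSpace 𝕜 F]
    {p : ℝ≥0∞} {f : Ω → F} (hf : MemLp f p P) :
    hf.toLp ∈ lpMeas F 𝕜 m p P ↔ AEStronglyMeasurable[m] f P :=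
  mem_lpMeas_iff_aestronglyMeasurable.trans (aestronglyMeasurable_congr hf.coeFn_toLp)

theorem lintegral_enorm_sq_eq {E : Type*} [NormedAddCommGroup E] (F : Lp E 2 P) :
    ∫⁻ ω, ‖F ω‖ₑ ^ 2 ∂P = ‖F‖ₑ ^ 2 := by
  simpa [Lp.enorm_def] using
    (eLpNorm_nnreal_pow_eq_lintegral (f := F) (μ := P) (p := 2) two_ne_zero).symm

theorem lintegral_enorm_condExp_sq_eq [IsFiniteMeasure P] [hm : Fact (m ≤ mΩ)] (F : Lp ℝ 2 P) :
    ∫⁻ ω, ‖(P[F | m]) ω‖ₑ ^ 2 ∂P = ‖(lpMeas ℝ ℝ m 2 P).starProjection F‖ₑ ^ 2 := by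
  have h : (lpMeas ℝ ℝ m 2 P).starProjection F =ᵐ[P] P[F | m] := by
    simpa only [Lp.toLp_coeFn] using! (Lp.memLp F).condExpL2_ae_eq_condExp (𝕜 := ℝ) hm.out
  rw [← lintegral_enorm_sq_eq]
  refine lintegral_congr_ae ?_
  filter_upwards [h] with ω hω
  rw [hω]

end ConditionalExpectation

section Ito

variable {X Ω : Type*} [MeasurableSpace X] {ν : Measure X} {W : Bfin ν → Ω → ℝ}

theorem measurable_cylinderAlgebra {𝒜 : CountablePartition ν} {A : Bfin ν} (hA : A.1 ∈ 𝒜.parts) :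
    Measurable[cylinderAlgebra W 𝒜] (W A) :=
  (comap_measurable _).mono (le_iSup (fun B : {B : Bfin ν // B.1 ∈ 𝒜.parts} =>
    MeasurableSpace.comap (W B.1) inferInstance) ⟨A, hA⟩) le_rfl

variable [mΩ : MeasurableSpace Ω] {P : Measure Ω} {φ : X → ℝ}

theorem itoIntegral_spec (h : ItoIntegrable P W φ) : IsItoIntegral P W φ (itoIntegral P W φ) := by
  rw [itoIntegral, dif_pos h]
  exact h.choose_spec

theorem secondMoment_lt_top_iff : secondMoment P W φ < ∞ ↔ ItoIntegrable P W φ := by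
  by_cases h : ItoIntegrable P W φ
  · simp [secondMoment, h, lintegral_enorm_sq_eq]
  · simp [secondMoment, h]

theorem cylinderAlgebra_le (hW : ∀ A, Measurable (W A)) (𝒜 : CountablePartition ν) :
    cylinderAlgebra W 𝒜 ≤ mΩ :=
  iSup_le fun A => (hW A.1).comap_le

variable {H : Type*} [NormedAddCommGroup H] [InnerProductSpace ℝ H] [CompleteSpace H]
  {S : Lp ℝ 2 ν →ₗ.[ℝ] H} {k : Bfin ν → H}
  (hS : S.IsClosed) (hk : ∀ A, (chi ν A, k A) ∈ S.graph) (hL2 : ∀ A, MemLp (W A) 2 P)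
  (hcov : ∀ A B, ∫ ω, W A ω * W B ω ∂P = ⟪k A, k B⟫_ℝ)

include hS hk hcov

theorem toLp_mem_topologicalClosure_span_of_eq_iUnion {ι : Type*} [Countable ι]
    {t : ι → Bfin ν} (hd : Pairwise (Disjoint on fun i => (t i).1)) {A : Bfin ν}
    (hA : A.1 = ⋃ i, (t i).1) :
    (hL2 A).toLp ∈ (Submodule.span ℝ (Set.range fun i => (hL2 (t i)).toLp)).topologicalClosure := by
  obtain ⟨U, hU⟩ := exists_clm_apply_eq_of_inner_eq (x := k) (y := fun A => (hL2 A).toLp)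
    fun A B => by rw [inner_toLp_toLp, hcov]
  rw [← hU]
  exact map_mem_topologicalClosure_span_range (fun i => hU (t i))
    (mem_topologicalClosure_span_of_eq_iUnion hS hk hd hA)

variable (hW : ∀ A, Measurable (W A))

include hL2 hW

theorem aestronglyMeasurable_cylinderAlgebra {𝒜 : CountablePartition ν} {A : Bfin ν}
    (hA : 𝒜.Saturates A.1) :
    AEStronglyMeasurable[cylinderAlgebra W 𝒜] (W A) P := by
  let t (B : {B : Bfin ν // B.1 ∈ 𝒜.parts ∧ B.1 ⊆ A.1}) : Bfin ν := B.1
  have hcount : Countable {B : Bfin ν // B.1 ∈ 𝒜.parts ∧ B.1 ⊆ A.1} :=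
    (Subtype.impEmbedding _ (fun B : Bfin ν => B.1 ∈ 𝒜.parts) fun _ hB => hB.1).injective.countable
  have hd : Pairwise (Disjoint on fun B => (t B).1) := fun B C hBC =>
    𝒜.isPartition.pairwiseDisjoint B.2.1 C.2.1 fun h => hBC (Subtype.ext (Subtype.ext h))
  have hspan : Submodule.span ℝ (Set.range fun B => (hL2 (t B)).toLp) ≤
      lpMeas ℝ ℝ (cylinderAlgebra W 𝒜) 2 P := by
    refine Submodule.span_le.2 (Set.range_subset_iff.2 fun B => ?_)
    exact (toLp_mem_lpMeas_iff _).2 (measurable_cylinderAlgebra B.2.1).aestronglyMeasurable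
  exact (toLp_mem_lpMeas_iff (hL2 A)).1 (Submodule.topologicalClosure_minimal _ hspan
    (isClosed_aestronglyMeasurable (cylinderAlgebra_le hW 𝒜))
    (toLp_mem_topologicalClosure_span_of_eq_iUnion hS hk hL2 hcov hd hA.eq_iUnion))

theorem lpMeas_cylinderAlgebra_mono {𝒜 𝒜' : CountablePartition ν} (h : 𝒜.RefinedBy 𝒜') :
    lpMeas ℝ ℝ (cylinderAlgebra W 𝒜) 2 P ≤ lpMeas ℝ ℝ (cylinderAlgebra W 𝒜') 2 P := by
  intro F hF
  rw [mem_lpMeas_iff_aestronglyMeasurable] at hF ⊢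
  exact aestronglyMeasurable_of_iSup_comap (fun A =>
    aestronglyMeasurable_cylinderAlgebra hS hk hL2 hcov hW (h.saturates A.2)) hF

theorem condSecondMoment_mono [IsFiniteMeasure P] {𝒜 𝒜' : CountablePartition ν}
    (h : 𝒜.RefinedBy 𝒜') :
    condSecondMoment P W φ 𝒜 ≤ condSecondMoment P W φ 𝒜' := by
  have hle (ℬ) : Fact (cylinderAlgebra W ℬ ≤ mΩ) := ⟨cylinderAlgebra_le hW ℬ⟩
  by_cases hφ : ItoIntegrable P W φ
  · simp only [condSecondMoment, if_pos hφ, lintegral_enorm_condExp_sq_eq]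
    gcongr
    exact enorm_le_iff_norm_le.2 (norm_starProjection_le_of_le
      (lpMeas_cylinderAlgebra_mono hS hk hL2 hcov hW h) _)
  · simp only [condSecondMoment, if_neg hφ, le_refl]

variable [SigmaFinite ν]

theorem mem_closure_iUnion_lpMeas_of_isItoIntegral {F : Lp ℝ 2 P} (hF : IsItoIntegral P W φ F) :
    F ∈ closure (⋃ 𝒜, (lpMeas ℝ ℝ (cylinderAlgebra W 𝒜) 2 P : Set (Lp ℝ 2 P))) := by
  obtain ⟨f, -, hF⟩ := hF
  rw [elementaryGraph_eq_span hL2] at hF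
  refine map_mem_closure continuous_snd hF fun p hp => ?_
  obtain ⟨c, rfl⟩ := Finsupp.mem_span_range_iff_exists_finsupp.1 hp
  obtain ⟨𝒜, h𝒜⟩ := CountablePartition.exists_forall_saturates (ν := ν)
    (A := fun A : c.support => A.1.1) fun A => A.1.2.1
  simp only [Finsupp.sum, Prod.snd_sum, Prod.smul_snd]
  refine Set.mem_iUnion.2 ⟨𝒜, Submodule.sum_mem _ fun A hA => Submodule.smul_mem _ _ ?_⟩
  exact (toLp_mem_lpMeas_iff _).2
    (aestronglyMeasurable_cylinderAlgebra hS hk hL2 hcov hW (h𝒜 ⟨A, hA⟩))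

theorem iSup_condSecondMoment [IsFiniteMeasure P] :
    ⨆ 𝒜, condSecondMoment P W φ 𝒜 = secondMoment P W φ := by
  have hle (𝒜) : Fact (cylinderAlgebra W 𝒜 ≤ mΩ) := ⟨cylinderAlgebra_le hW 𝒜⟩
  by_cases hφ : ItoIntegrable P W φ
  · simp only [condSecondMoment, secondMoment, if_pos hφ, lintegral_enorm_condExp_sq_eq,
      lintegral_enorm_sq_eq]
    rw [← ENNReal.iSup_pow_of_ne_zero two_ne_zero, iSup_enorm_starProjection _
      (mem_closure_iUnion_lpMeas_of_isItoIntegral hS hk hL2 hcov hW (itoIntegral_spec hφ))]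
  · simp only [condSecondMoment, secondMoment, if_neg hφ, iSup_const]

end Ito

end GaussianField

open GaussianField in
theorem corollary5p2_general {X Ω H : Type*} [MeasurableSpace X] [MeasurableSpace Ω]
    [NormedAddCommGroup H] [InnerProductSpace ℝ H] [CompleteSpace H]
    (ν : Measure X) [SigmaFinite ν] (P : Measure Ω) [IsFiniteMeasure P]
    (S : Lp ℝ 2 ν →ₗ.[ℝ] H) (hS : S.IsClosed) (hcore : S.HasCore (Dfin ν))
    (k : Bfin ν → H) (hk : ∀ A, (chi ν A, k A) ∈ S.graph)
    (W : Bfin ν → Ω → ℝ) (hW : ∀ A, Measurable (W A)) (hL2 : ∀ A, MemLp (W A) 2 P)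
    (hcov : ∀ A B, ∫ ω, W A ω * W B ω ∂P = ⟪k A, k B⟫_ℝ) (φ : X → ℝ) :
    (∀ 𝒜 𝒜' : CountablePartition ν, 𝒜.RefinedBy 𝒜' →
        condSecondMoment P W φ 𝒜 ≤ condSecondMoment P W φ 𝒜') ∧
      (⨆ 𝒜 : CountablePartition ν, condSecondMoment P W φ 𝒜) = secondMoment P W φ ∧
      ((⨆ 𝒜 : CountablePartition ν, condSecondMoment P W φ 𝒜) < ∞ ↔
        ∃ f ∈ S.domain, f =ᵐ[ν] φ) := by
  have hsup := iSup_condSecondMoment (φ := φ) hS hk hL2 hcov hW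
  refine ⟨fun 𝒜 𝒜' h => condSecondMoment_mono hS hk hL2 hcov hW h, hsup, ?_⟩
  rw [hsup, secondMoment_lt_top_iff, itoIntegrable_iff hS hcore hk hL2 hcov]

open GaussianField in
theorem corollary5p2 {X Ω : Type*} [MeasurableSpace X] [MeasurableSpace Ω]
    (ν : Measure X) [SigmaFinite ν] (P : Measure Ω) [IsProbabilityMeasure P]
    -- the closed operator `S` with core `𝓓_fin`, and the factorization `k_A = S χ_A` of `K`
    (S : Lp ℝ 2 ν →ₗ.[ℝ] Lp ℝ 2 ν) (hS : S.IsClosed) (hcore : S.HasCore (Dfin ν))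
    (k : Bfin ν → Lp ℝ 2 ν) (hk : ∀ A, (chi ν A, k A) ∈ S.graph)
    (K : Bfin ν → Bfin ν → ℝ) (hK : ∀ A B, K A B = ⟪k A, k B⟫_ℝ)
    -- the centered Gaussian process `W` with covariance kernel `K`
    (W : Bfin ν → Ω → ℝ) (hW : ∀ A, Measurable (W A)) (hG : IsGaussianProcess W P)
    (hmean : ∀ A, ∫ ω, W A ω ∂P = 0)
    (hcov : ∀ A B, ∫ ω, W A ω * W B ω ∂P = K A B)
    (φ : X → ℝ) (hφ : Measurable φ) :
    (∀ 𝒜 𝒜' : CountablePartition ν, 𝒜.RefinedBy 𝒜' →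
        condSecondMoment P W φ 𝒜 ≤ condSecondMoment P W φ 𝒜') ∧
      (⨆ 𝒜 : CountablePartition ν, condSecondMoment P W φ 𝒜) = secondMoment P W φ ∧
      ((⨆ 𝒜 : CountablePartition ν, condSecondMoment P W φ 𝒜) < ∞ ↔ InDomain S φ) := by
  obtain rfl : K = fun A B => ⟪k A, k B⟫_ℝ := funext₂ hK
  exact corollary5p2_general ν P S hS hcore k hk W hW
    (fun A => (hG.hasGaussianLaw_eval A).memLp_two) hcov φ
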